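/- All rings are associative with identity, not necessarily commutative. For a ring $S$, let $\mathrm{nil}(S)$ be its set of nilpotent elements; $S$ is reduced if $\mathrm{nil}(S)=\{0\}$, and $2$-primal if $\mathrm{nil}(S)$ equals the prime radical of $S$ (the intersection of all its prime two-sided ideals). Let $Z_N^*(S)$ be the set of non-zero $a\in S$ such that $ab\in\mathrm{nil}(S)$ for some non-zero $b\in S$. The nilpotent graph $\Gamma_N(S)$ has vertex set $Z_N^*(S)$, and two distinct vertices $a,b$ are adjacent if and only if $ab\in\mathrm{nil}(S)$. The girth $gr(\Gamma)$ of a graph $\Gamma$ is the length of a shortest cycle, and $gr(\Gamma)=\infty$ if $\Gamma$ has no cycle. Let $n\ge 1$. A ring $A$ is a skew PBW extension $\sigma(R)\langle x_1,\dots,x_n\rangle$ of a subring $R$ (with the same identity) in the elements $x_1,\dots,x_n\in A$ if: the standard monomials $x^\alpha=x_1^{\alpha_1}\cdots x_n^{\alpha_n}$, $\alpha\in\mathbb N^n$, form a basis of $A$ as a left $R$-module; for all $i$ and all non-zero $r\in R$ there is a non-zero $c_{i,r}\in R$ with $x_ir-c_{i,r}x_i\in R$; and for all $1\le i,j\le n$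 there is a non-zero $d_{i,j}\in R$ with $x_jx_i-d_{i,j}x_ix_j\in R+Rx_1+\cdots+Rx_n$. Then $x_ir=\sigma_i(r)x_i+\delta_i(r)$ for all $r\in R$, with uniquely determined maps $\sigma_i,\delta_i:R\to R$, where $\sigma_i$ is an injective ring endomorphism and $\delta_i$ a $\sigma_i$-derivation. Put $\sigma^\alpha=\sigma_1^{\alpha_1}\circ\cdots\circ\sigma_n^{\alpha_n}$ and $\delta^\beta=\delta_1^{\beta_1}\circ\cdots\circ\delta_n^{\beta_n}$ for $\alpha,\beta\in\mathbb N^n$. The ring $R$ is $(\Sigma,\Delta)$-compatible if for all $a,b\in R$ and $\alpha,\beta\in\mathbb N^n$: $a\sigma^\alpha(b)=0$ if and only if $ab=0$; and $ab=0$ implies $a\delta^\beta(b)=0$. **Theorem.** Let $n\ge 1$ and let $A=\sigma(R)\langle x_1,\dots,x_n\rangle$ be a skew PBW extension of $R$. If $R$ is $(\Sigma,\Delta)$-compatible and $2$-primal, $gr(\Gamma_N(R))=\infty$ and $Z_N^*(R)\neq\emptyset$, then either $|\mathrm{nil}(R)|=2$ and $gr(\Gamma_N(A))=3$, or $R$ is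 reduced and $gr(\Gamma_N(A))=4$. -/

import Mathlib

/-! ### 2-primal rings and the nilpotent graph -/

/-- A two-sided ideal `P` of a (not necessarily commutative) ring is prime if it is proper and
`I J ⊆ P` implies `I ⊆ P` or `J ⊆ P` for all two-sided ideals `I`, `J`. -/
def TwoSidedIdeal.IsPrimeIdeal {S : Type*} [Ring S] (P : TwoSidedIdeal S) : Prop :=
  P ≠ ⊤ ∧ ∀ I J : TwoSidedIdeal S, (∀ a ∈ I, ∀ b ∈ J, a * b ∈ P) → I ≤ P ∨ J ≤ P

/-- The prime radical: the intersection of all prime two-sided ideals. -/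
def primeRadical (S : Type*) [Ring S] : TwoSidedIdeal S :=
  sInf {P : TwoSidedIdeal S | P.IsPrimeIdeal}

/-- The set `nil(S)` of nilpotent elements. -/
def nilSet (S : Type*) [Ring S] : Set S := {a | IsNilpotent a}

/-- `S` is 2-primal if its prime radical equals its set of nilpotent elements. -/
def IsTwoPrimal (S : Type*) [Ring S] : Prop :=
  (primeRadical S : Set S) = nilSet S

/-- `Z_N^*(S)`: the non-zero elements `a` such that `a * b` is nilpotent for some non-zero `b`. -/
def nilZeroDivisors (S : Type*) [Ring S] : Set S :=
  {a | a ≠ 0 ∧ ∃ b : S, b ≠ 0 ∧ a * b ∈ nilSet S}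

theorem mul_mem_nilSet_symm {S : Type*} [Ring S] {a b : S} (h : a * b ∈ nilSet S) :
    b * a ∈ nilSet S := by
  obtain ⟨k, hk⟩ := h
  refine ⟨k + 1, ?_⟩
  have key : ∀ m : ℕ, (b * a) ^ (m + 1) = b * (a * b) ^ m * a := by
    intro m
    induction m with
    | zero => simp
    | succ m ih => rw [pow_succ, ih, pow_succ (a * b)]; simp only [mul_assoc]
  rw [key, hk]
  simp

/-- The nilpotent graph `Γ_N(S)`: vertex set `Z_N^*(S)`, and two distinct vertices `a`, `b` are
adjacent if and only if `a * b` is nilpotent. -/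
def nilpotentGraph (S : Type*) [Ring S] : SimpleGraph (nilZeroDivisors S) where
  Adj a b := a ≠ b ∧ (a : S) * (b : S) ∈ nilSet S
  symm := ⟨fun _ _ h => ⟨h.1.symm, mul_mem_nilSet_symm h.2⟩⟩
  loopless := ⟨fun _ h => h.1 rfl⟩

/-! ### Skew PBW extensions -/

/-- The standard monomial `x^α = x_1^{α_1} ⋯ x_n^{α_n}` (factors in this order). -/
def stdMonomial {A : Type*} [Ring A] {n : ℕ} (x : Fin n → A) (α : Fin n → ℕ) : A :=
  (List.ofFn fun i => x i ^ α i).prod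

/-- `A` is a skew PBW extension `σ(R)⟨x_1, …, x_n⟩` of its subring `R` in the elements
`x_1, …, x_n`. -/
structure IsSkewPBWExtension {A : Type*} [Ring A] (R : Subring A) {n : ℕ} (x : Fin n → A) :
    Prop where
  linearIndependent : LinearIndependent R (stdMonomial x)
  span_eq_top : Submodule.span R (Set.range (stdMonomial x)) = ⊤
  exists_coeff : ∀ (i : Fin n) (r : R), r ≠ 0 →
    ∃ c : R, c ≠ 0 ∧ x i * (r : A) - (c : A) * x i ∈ R
  exists_comm : ∀ i j : Fin n, ∃ d : R, d ≠ 0 ∧ ∃ (r₀ : R) (r : Fin n → R),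
    x j * x i - (d : A) * (x i * x j) = (r₀ : A) + ∑ k, (r k : A) * x k

theorem stdMonomial_zero {A : Type*} [Ring A] {n : ℕ} (x : Fin n → A) :
    stdMonomial x 0 = 1 := by
  simp [stdMonomial]

theorem stdMonomial_single {A : Type*} [Ring A] {n : ℕ} (x : Fin n → A) (i : Fin n) :
    stdMonomial x (Pi.single i 1) = x i := by
  induction n with
  | zero => exact i.elim0
  | succ n ih =>
    unfold stdMonomial at ih ⊢
    rw [List.ofFn_succ, List.prod_cons]
    refine Fin.cases ?_ (fun j => ?_) i
    · simp
    · have h := ih (fun k => x k.succ) j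
      have e : (fun k : Fin n => x k.succ ^ (Pi.single j.succ 1 : Fin (n + 1) → ℕ) k.succ)
          = fun k => x k.succ ^ (Pi.single j 1 : Fin n → ℕ) k := by
        funext k
        simp [Pi.single_apply]
      rw [e, h]
      simp

namespace IsSkewPBWExtension

variable {A : Type*} [Ring A] {R : Subring A} {n : ℕ} {x : Fin n → A}

/-- The basis of the left `R`-module `A` consisting of the standard monomials. -/
noncomputable def basis (h : IsSkewPBWExtension R x) : Module.Basis (Fin n → ℕ) R A :=
  Module.Basis.mk h.linearIndependent h.span_eq_top.ge

theorem repr_linear (h : IsSkewPBWExtension R x) (i : Fin n) (c d : R) :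
    h.basis.repr ((c : A) * x i + d) =
      Finsupp.single (Pi.single i 1) c + Finsupp.single 0 d := by
  have h1 : (c : A) * x i + d = c • h.basis (Pi.single i 1) + d • h.basis 0 := by
    simp [basis, stdMonomial_zero, stdMonomial_single, Subring.smul_def]
  rw [h1]
  simp

theorem repr_linear_single (h : IsSkewPBWExtension R x) (i : Fin n) (c d : R) :
    h.basis.repr ((c : A) * x i + d) (Pi.single i 1) = c := by
  have : (0 : Fin n → ℕ) ≠ Pi.single i 1 := by
    intro e
    simpa using congrFun e i
  rw [repr_linear, Finsupp.add_apply, Finsupp.single_eq_same, Finsupp.single_apply, if_neg this,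
    add_zero]

theorem repr_linear_zero (h : IsSkewPBWExtension R x) (i : Fin n) (c d : R) :
    h.basis.repr ((c : A) * x i + d) 0 = d := by
  have : (Pi.single i 1 : Fin n → ℕ) ≠ 0 := by
    intro e
    simpa using congrFun e i
  rw [repr_linear, Finsupp.add_apply, Finsupp.single_eq_same, Finsupp.single_apply, if_neg this,
    zero_add]

theorem mul_eq_aux (h : IsSkewPBWExtension R x) (i : Fin n) (r : R) :
    x i * (r : A) = (h.basis.repr (x i * (r : A)) (Pi.single i 1) : A) * x i
      + (h.basis.repr (x i * (r : A)) 0 : A) := by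
  have hex : ∃ c d : R, x i * (r : A) = (c : A) * x i + d := by
    by_cases hr : r = 0
    · exact ⟨0, 0, by simp [hr]⟩
    · obtain ⟨c, -, hc⟩ := h.exists_coeff i r hr
      exact ⟨c, ⟨_, hc⟩, by simp⟩
  obtain ⟨c, d, e⟩ := hex
  rw [e, repr_linear_single, repr_linear_zero]

/-- The endomorphism `σ_i` of `R`, determined by `x_i r = σ_i(r) x_i + δ_i(r)`: `σ_i(r)` is the
coefficient of `x_i` in `x_i r`. -/
noncomputable def sigma (h : IsSkewPBWExtension R x) (i : Fin n) : R →+* R where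
  toFun r := h.basis.repr (x i * (r : A)) (Pi.single i 1)
  map_zero' := by simp
  map_add' r s := by simp [mul_add]
  map_one' := by
    have := h.repr_linear_single i 1 0
    simpa using this
  map_mul' r s := by
    have e : x i * ((r * s : R) : A) =
        ((h.basis.repr (x i * (r : A)) (Pi.single i 1)
          * h.basis.repr (x i * (s : A)) (Pi.single i 1) : R) : A) * x i
        + ((h.basis.repr (x i * (r : A)) (Pi.single i 1) * h.basis.repr (x i * (s : A)) 0
          + h.basis.repr (x i * (r : A)) 0 * s : R) : A) := by
      have h1 := h.mul_eq_aux i r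
      have h2 := h.mul_eq_aux i s
      generalize h.basis.repr (x i * (r : A)) (Pi.single i 1) = a at *
      generalize h.basis.repr (x i * (r : A)) 0 = b at *
      generalize h.basis.repr (x i * (s : A)) (Pi.single i 1) = c at *
      generalize h.basis.repr (x i * (s : A)) 0 = d at *
      push_cast
      rw [← mul_assoc, h1, add_mul, mul_assoc, h2]
      noncomm_ring
    rw [e, repr_linear_single]

/-- The `σ_i`-derivation `δ_i` of `R`, determined by `x_i r = σ_i(r) x_i + δ_i(r)`: `δ_i(r)` is
the constant coefficient of `x_i r`. -/
noncomputable def delta (h : IsSkewPBWExtension R x) (i : Fin n) : R →+ R where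
  toFun r := h.basis.repr (x i * (r : A)) 0
  map_zero' := by simp
  map_add' r s := by simp [mul_add]

theorem x_mul (h : IsSkewPBWExtension R x) (i : Fin n) (r : R) :
    x i * (r : A) = (h.sigma i r : A) * x i + (h.delta i r : A) :=
  h.mul_eq_aux i r

/-- `σ^α = σ_1^{α_1} ∘ ⋯ ∘ σ_n^{α_n}`. -/
noncomputable def sigmaPow (h : IsSkewPBWExtension R x) (α : Fin n → ℕ) : R → R :=
  (List.ofFn fun i => (h.sigma i)^[α i]).foldr (fun f g => f ∘ g) id

/-- `δ^β = δ_1^{β_1} ∘ ⋯ ∘ δ_n^{β_n}`. -/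
noncomputable def deltaPow (h : IsSkewPBWExtension R x) (β : Fin n → ℕ) : R → R :=
  (List.ofFn fun i => (h.delta i)^[β i]).foldr (fun f g => f ∘ g) id

/-- `R` is `Σ`-compatible. -/
def SigmaCompatible (h : IsSkewPBWExtension R x) : Prop :=
  ∀ (a b : R) (α : Fin n → ℕ), a * h.sigmaPow α b = 0 ↔ a * b = 0

/-- `R` is `Δ`-compatible. -/
def DeltaCompatible (h : IsSkewPBWExtension R x) : Prop :=
  ∀ (a b : R) (β : Fin n → ℕ), a * b = 0 → a * h.deltaPow β b = 0

/-- `R` is `(Σ, Δ)`-compatible. -/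
def Compatible (h : IsSkewPBWExtension R x) : Prop :=
  h.SigmaCompatible ∧ h.DeltaCompatible

end IsSkewPBWExtension

/-!
The girth of `Γ_N(A)` is decided by whether `R` contains an element `a ≠ 0` with `a² = 0`.

In a ring whose nilpotent graph is triangle-free, such an `a` satisfies `a r ∈ {0, a}` for every
`r`: otherwise two nilpotent elements together with `1`, or `a`, `a r` and `1 - a r`, form a
triangle. In `R` this leaves `0` and `a` as the only nilpotent elements; in `A` it fails for
`r = x_i`, so `Γ_N(A)` has a triangle.

If there is no such `a`, order the exponents degree-lexicographically. The leading coefficient of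
`x^α r x^β` is `σ^α(r)` times a coefficient coming from the commutation relations of the variables,
which is a unit because reduced rings are Dedekind-finite. By `Σ`-compatibility `f g = 0` therefore
makes the product of the leading coefficients of `f` and `g` vanish. Hence `A` is reduced, and a
triangle in `Γ_N(A)` descends to one in `Γ_N(R)`, while `a b = 0` in `R` produces the 4-cycle
`a, b, a x_i, b x_i` in `Γ_N(A)`.
-/

/-! ### Reduced rings -/

theorem mul_mul_eq_zero_of_isReduced {M : Type*} [MonoidWithZero M] [IsReduced M] {a b : M}
    (hab : a * b = 0) (c : M) : b * c * a = 0 :=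
  IsReduced.eq_zero _ ⟨2, by rw [sq, mul_assoc, ← mul_assoc a, ← mul_assoc a, hab, zero_mul,
    zero_mul, mul_zero]⟩

theorem mul_eq_zero_symm_of_isReduced {M : Type*} [MonoidWithZero M] [IsReduced M] {a b : M}
    (hab : a * b = 0) : b * a = 0 := by
  simpa only [mul_one] using mul_mul_eq_zero_of_isReduced hab 1

theorem isDedekindFiniteMonoid_of_isReduced {S : Type*} [Ring S] [IsReduced S] :
    IsDedekindFiniteMonoid S where
  mul_eq_one_symm {a b} hab := by
    have h_right : a * (1 - b * a) = 0 := by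
      rw [mul_sub, mul_one, ← mul_assoc, hab, one_mul, sub_self]
    have h_left : (1 - b * a) * a = 0 := mul_eq_zero_symm_of_isReduced h_right
    refine (sub_eq_zero.1 ?_).symm
    calc 1 - b * a = (1 - b * a) * a * b := by rw [mul_assoc, hab, mul_one]
      _ = 0 := by rw [h_left, zero_mul]

theorem ne_of_mul_eq_zero_of_isReduced {M : Type*} [MonoidWithZero M] [IsReduced M] {a b : M}
    (ha : a ≠ 0) (hab : a * b = 0) : a ≠ b := by
  rintro rfl
  exact ha (IsReduced.eq_zero a ⟨2, by rwa [sq]⟩)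

/-! ### Short cycles in the nilpotent graph -/

theorem egirth_eq_three_iff {V : Type*} {G : SimpleGraph V} :
    G.egirth = 3 ↔ ∃ a b c, G.Adj a b ∧ G.Adj a c ∧ G.Adj b c := by
  classical
  constructor
  · intro hG
    obtain ⟨a, w, hw, hlen⟩ := SimpleGraph.exists_egirth_eq_length.2
      fun hacyc => ENat.top_ne_ofNat 3 ((SimpleGraph.egirth_eq_top.2 hacyc).symm.trans hG)
    have hw3 : w.length = 3 := by exact_mod_cast hlen.symm.trans hG
    obtain ⟨s, hs⟩ := SimpleGraph.is3Clique_iff_exists_cycle_length_three.2 ⟨a, w, hw, hw3⟩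
    obtain ⟨a, b, c, hab, hac, hbc, -⟩ := SimpleGraph.is3Clique_iff.1 hs
    exact ⟨a, b, c, hab, hac, hbc⟩
  · rintro ⟨a, b, c, hab, hac, hbc⟩
    obtain ⟨u, w, hw, hlen⟩ := SimpleGraph.is3Clique_iff_exists_cycle_length_three.1
      ⟨_, SimpleGraph.is3Clique_triple_iff.2 ⟨hab, hac, hbc⟩⟩
    refine le_antisymm ?_ SimpleGraph.three_le_egirth
    simpa only [hlen, Nat.cast_ofNat] using SimpleGraph.egirth_le_length hw

theorem egirth_le_four {V : Type*} {G : SimpleGraph V} {a b c d : V} (hab : G.Adj a b)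
    (hbc : G.Adj b c) (hcd : G.Adj c d) (hda : G.Adj d a) (hac : a ≠ c) (hbd : b ≠ d) :
    G.egirth ≤ 4 := by
  let w : G.Walk a a := .cons hab (.cons hbc (.cons hcd (.cons hda .nil)))
  have hw : w.IsCycle := by
    simp [w, SimpleGraph.Walk.isCycle_def, hab.ne, hab.ne', hbc.ne, hcd.ne, hda.ne, hda.ne', hac,
      hac.symm, hbd]
  exact SimpleGraph.egirth_le_length hw

section NilpotentGraph

variable {S : Type*} [Ring S]

theorem egirth_nilpotentGraph_eq_three_iff :
    (nilpotentGraph S).egirth = 3 ↔ ∃ a b c : S, (a ≠ 0 ∧ b ≠ 0 ∧ c ≠ 0) ∧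
      (a ≠ b ∧ a ≠ c ∧ b ≠ c) ∧ a * b ∈ nilSet S ∧ a * c ∈ nilSet S ∧ b * c ∈ nilSet S := by
  rw [egirth_eq_three_iff]
  constructor
  · rintro ⟨a, b, c, hab, hac, hbc⟩
    exact ⟨a, b, c, ⟨a.2.1, b.2.1, c.2.1⟩, ⟨Subtype.coe_injective.ne hab.1,
      Subtype.coe_injective.ne hac.1, Subtype.coe_injective.ne hbc.1⟩, hab.2, hac.2, hbc.2⟩
  · rintro ⟨a, b, c, ⟨ha, hb, hc⟩, ⟨hab, hac, hbc⟩, hab', hac', hbc'⟩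
    exact ⟨⟨a, ha, b, hb, hab'⟩, ⟨b, hb, c, hc, hbc'⟩, ⟨c, hc, b, hb, mul_mem_nilSet_symm hbc'⟩,
      ⟨fun e => hab (congrArg Subtype.val e), hab'⟩, ⟨fun e => hac (congrArg Subtype.val e), hac'⟩,
      ⟨fun e => hbc (congrArg Subtype.val e), hbc'⟩⟩

theorem mem_nilSet_iff_eq_zero [IsReduced S] {a : S} : a ∈ nilSet S ↔ a = 0 :=
  isNilpotent_iff_eq_zero

theorem egirth_nilpotentGraph_eq_three_iff_of_isReduced [IsReduced S] :
    (nilpotentGraph S).egirth = 3 ↔ ∃ a b c : S, (a ≠ 0 ∧ b ≠ 0 ∧ c ≠ 0) ∧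
      a * b = 0 ∧ a * c = 0 ∧ b * c = 0 := by
  simp only [egirth_nilpotentGraph_eq_three_iff, mem_nilSet_iff_eq_zero]
  constructor
  · rintro ⟨a, b, c, hne, -, hmul⟩
    exact ⟨a, b, c, hne, hmul⟩
  · rintro ⟨a, b, c, hne, hab, hac, hbc⟩
    exact ⟨a, b, c, hne, ⟨ne_of_mul_eq_zero_of_isReduced hne.1 hab,
      ne_of_mul_eq_zero_of_isReduced hne.1 hac, ne_of_mul_eq_zero_of_isReduced hne.2.1 hbc⟩,
      hab, hac, hbc⟩

theorem egirth_nilpotentGraph_le_four_of_isReduced [IsReduced S] {a b y : S} (ha : a ≠ 0)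
    (hb : b ≠ 0) (hab : a * b = 0) (hay : a * y ≠ 0) (hby : b * y ≠ 0) (hay' : a * y ≠ a)
    (hby' : b * y ≠ b) : (nilpotentGraph S).egirth ≤ 4 := by
  have hba : b * a = 0 := mul_eq_zero_symm_of_isReduced hab
  have h_ay : b * (a * y) = 0 := by rw [← mul_assoc, hba, zero_mul]
  have h_by : a * y * (b * y) = 0 := by
    rw [← mul_assoc, mul_mul_eq_zero_of_isReduced hba, zero_mul]
  have h_a : b * y * a = 0 := mul_mul_eq_zero_of_isReduced hab y
  have hadj {p q : S} (hp : p ≠ 0) (hpq : p * q = 0) : p ≠ q ∧ p * q ∈ nilSet S :=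
    ⟨ne_of_mul_eq_zero_of_isReduced hp hpq, mem_nilSet_iff_eq_zero.2 hpq⟩
  have hvertex {p q : S} (hp : p ≠ 0) (hq : q ≠ 0) (hpq : p * q = 0) : p ∈ nilZeroDivisors S :=
    ⟨hp, q, hq, mem_nilSet_iff_eq_zero.2 hpq⟩
  refine egirth_le_four (G := nilpotentGraph S) (a := ⟨a, hvertex ha hb hab⟩)
    (b := ⟨b, hvertex hb hay h_ay⟩) (c := ⟨a * y, hvertex hay hby h_by⟩)
    (d := ⟨b * y, hvertex hby ha h_a⟩) ?_ ?_ ?_ ?_ ?_ ?_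
  all_goals simp only [nilpotentGraph, ne_eq, Subtype.mk.injEq]
  exacts [hadj ha hab, hadj hb h_ay, hadj hay h_by, hadj hby h_a, hay'.symm, hby'.symm]

theorem eq_of_mem_nilSet_of_mul_mem_nilSet (hS : (nilpotentGraph S).egirth ≠ 3) {a b : S}
    (ha0 : a ≠ 0) (hb0 : b ≠ 0) (ha : a ∈ nilSet S) (hb : b ∈ nilSet S)
    (hab : a * b ∈ nilSet S) : a = b := by
  have : Nontrivial S := ⟨a, 0, ha0⟩
  have ne_one {c : S} (hc : c ∈ nilSet S) : c ≠ 1 := by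
    rintro rfl
    exact not_isNilpotent_one hc
  by_contra hne
  exact hS (egirth_nilpotentGraph_eq_three_iff.2 ⟨a, b, 1, ⟨ha0, hb0, one_ne_zero⟩,
    ⟨hne, ne_one ha, ne_one hb⟩, hab, by rwa [mul_one], by rwa [mul_one]⟩)

theorem mul_mul_self_ne (hS : (nilpotentGraph S).egirth ≠ 3) {a : S} (ha0 : a ≠ 0)
    (haa : a * a = 0) (r : S) : a * r * a ≠ a := by
  intro h
  -- The square-zero element `a` and the orthogonal idempotents `a * r`, `1 - a * r` are a triangle.
  have h_idem : a * r * (1 - a * r) = 0 := by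
    rw [mul_sub, mul_one, ← mul_assoc, h, sub_self]
  have h_left : a * (a * r) = 0 := by rw [← mul_assoc, haa, zero_mul]
  have h_right : a * (1 - a * r) = a := by rw [mul_sub, mul_one, h_left, sub_zero]
  have ha_nil : a ∈ nilSet S := ⟨2, by rw [sq, haa]⟩
  have h_ne_zero : a * r ≠ 0 := fun e => ha0 (by rw [← h, e, zero_mul])
  have h_self : a * r * (a * r) = a * r := by rw [← mul_assoc, h]
  refine hS (egirth_nilpotentGraph_eq_three_iff.2 ⟨a, a * r, 1 - a * r,
    ⟨ha0, h_ne_zero, fun e => ha0 (by rw [← h_right, e, mul_zero])⟩,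
    ⟨fun e => ha0 ?_, fun e => ha0 ?_, fun e => h_ne_zero ?_⟩, ?_, ?_, ?_⟩)
  · rw [← h, ← e, haa]
  · calc a = a * (1 - a * r) := h_right.symm
      _ = 0 := by rw [← e, haa]
  · calc a * r = a * r * (a * r) := h_self.symm
      _ = a * r * (1 - a * r) := by rw [← e]
      _ = 0 := h_idem
  · rw [h_left]
    exact IsNilpotent.zero
  · rwa [h_right]
  · rw [h_idem]
    exact IsNilpotent.zero

theorem mul_eq_zero_or_mul_eq_self (hS : (nilpotentGraph S).egirth ≠ 3) {a : S} (ha0 : a ≠ 0)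
    (haa : a * a = 0) (r : S) : a * r = 0 ∨ a * r = a := by
  have ha : a ∈ nilSet S := ⟨2, by rw [sq, haa]⟩
  have eq_zero_or_eq {b : S} (hab : a * b = 0) (hb : b ∈ nilSet S) : b = 0 ∨ b = a := by
    by_cases hb0 : b = 0
    · exact Or.inl hb0
    · refine Or.inr (eq_of_mem_nilSet_of_mul_mem_nilSet hS ha0 hb0 ha hb ?_).symm
      rw [hab]
      exact IsNilpotent.zero
  have h_ara : a * r * a = 0 := by
    refine (eq_zero_or_eq ?_ ⟨2, ?_⟩).resolve_right (mul_mul_self_ne hS ha0 haa r)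
    · rw [← mul_assoc, ← mul_assoc, haa, zero_mul, zero_mul]
    · rw [sq, mul_assoc, ← mul_assoc a (a * r), ← mul_assoc a a, haa, zero_mul, zero_mul, mul_zero]
  refine eq_zero_or_eq ?_ ⟨2, ?_⟩
  · rw [← mul_assoc, haa, zero_mul]
  · rw [sq, ← mul_assoc, h_ara, zero_mul]

theorem nilSet_eq_pair (hS : (nilpotentGraph S).egirth ≠ 3) {a : S} (ha0 : a ≠ 0)
    (haa : a * a = 0) : nilSet S = {0, a} := by
  have ha : a ∈ nilSet S := ⟨2, by rw [sq, haa]⟩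
  refine Set.Subset.antisymm (fun b hb => ?_) (Set.pair_subset IsNilpotent.zero ha)
  by_cases hb0 : b = 0
  · exact Or.inl hb0
  have hab : a * b = 0 := by
    refine (mul_eq_zero_or_mul_eq_self hS ha0 haa b).resolve_right fun hab => ?_
    obtain ⟨k, hk⟩ := hb
    have h_pow (m : ℕ) : a * b ^ m = a := by
      induction m with
      | zero => rw [pow_zero, mul_one]
      | succ m ih => rw [pow_succ', ← mul_assoc, hab, ih]
    exact ha0 (by rw [← h_pow k, hk, mul_zero])
  refine Or.inr (eq_of_mem_nilSet_of_mul_mem_nilSet hS ha0 hb0 ha hb ?_).symm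
  rw [hab]
  exact IsNilpotent.zero

end NilpotentGraph

/-! ### Exponents -/

theorem sum_add_single {n : ℕ} (α : Fin n → ℕ) (i : Fin n) :
    ∑ k, (α + Pi.single i 1 : Fin n → ℕ) k = ∑ k, α k + 1 := by
  simp [Finset.sum_add_distrib]

theorem exists_eq_add_single_first {n : ℕ} {α : Fin n → ℕ} (hα : α ≠ 0) :
    ∃ (j : Fin n) (β : Fin n → ℕ), α = β + Pi.single j 1 ∧ ∀ k < j, β k = 0 := by
  obtain ⟨i, hi⟩ := Function.ne_iff.1 hα
  obtain ⟨j, hj, hmin⟩ := WellFounded.has_min wellFounded_lt {k | α k ≠ 0} ⟨i, hi⟩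
  refine ⟨j, α - Pi.single j 1, (tsub_add_cancel_of_le ?_).symm, fun k hk => ?_⟩
  · intro k
    rcases eq_or_ne k j with rfl | hk
    · simpa [Nat.one_le_iff_ne_zero] using hj
    · simp [hk]
  · have hαk : α k = 0 := by_contra fun hne => hmin k hne hk
    simp [hαk]

theorem prod_ofFn_pow_add_single {M : Type*} [Monoid M] {n : ℕ} (f : Fin n → M) (α : Fin n → ℕ)
    (j : Fin n) (hα : ∀ k < j, α k = 0) :
    (List.ofFn fun k => f k ^ (α + Pi.single j 1 : Fin n → ℕ) k).prod =
      f j * (List.ofFn fun k => f k ^ α k).prod := by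
  induction n with
  | zero => exact j.elim0
  | succ n ih =>
    simp only [List.ofFn_succ, List.prod_cons]
    induction j using Fin.cases with
    | zero => simp [pow_succ', mul_assoc]
    | succ j =>
      have h_tail : (fun k : Fin n => (α + Pi.single j.succ 1 : Fin (n + 1) → ℕ) k.succ) =
          (fun k => α k.succ) + Pi.single j 1 := by
        funext k
        simp [Pi.single_apply]
      have h_prod := ih (fun k => f k.succ) (fun k => α k.succ) j
        fun k hk => hα k.succ (Fin.succ_lt_succ_iff.2 hk)
      rw [← h_tail] at h_prod
      simpa [hα 0 (Fin.succ_pos j)] using h_prod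

theorem stdMonomial_add_single {A : Type*} [Ring A] {n : ℕ} (x : Fin n → A) (α : Fin n → ℕ)
    (j : Fin n) (hα : ∀ k < j, α k = 0) :
    stdMonomial x (α + Pi.single j 1) = x j * stdMonomial x α :=
  prod_ofFn_pow_add_single x α j hα

/-- The weight `(|α|, α)` of an exponent `α`, whose order is the degree-lexicographic order; as an
additive map it makes that order visibly compatible with addition of exponents. -/
def degLexWeight {n : ℕ} : (Fin n → ℕ) →+ ℕ ×ₗ Lex (Fin n → ℕ) where
  toFun α := toLex (∑ k, α k, toLex α)
  map_zero' := by simp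
  map_add' α β := by
    rw [← toLex_add, Prod.mk_add_mk, ← toLex_add, ← Finset.sum_add_distrib]
    rfl

theorem degLexWeight_injective {n : ℕ} :
    Function.Injective (degLexWeight : (Fin n → ℕ) →+ ℕ ×ₗ Lex (Fin n → ℕ)) :=
  fun _ _ h => toLex.injective (congrArg Prod.snd (toLex.injective h))

theorem degLexWeight_lt_of_sum_lt {n : ℕ} {α β : Fin n → ℕ} (h : ∑ k, α k < ∑ k, β k) :
    degLexWeight α < degLexWeight β :=
  Prod.Lex.toLex_lt_toLex.2 (Or.inl h)

theorem degLexWeight_add_lt_add_right {n : ℕ} {α β : Fin n → ℕ}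
    (h : degLexWeight α < degLexWeight β) (γ : Fin n → ℕ) :
    degLexWeight (α + γ) < degLexWeight (β + γ) := by
  rw [map_add, map_add]
  exact add_lt_add_left h _

theorem degLexWeight_lt_add_single {n : ℕ} (α : Fin n → ℕ) (i : Fin n) :
    degLexWeight α < degLexWeight (α + Pi.single i 1) :=
  degLexWeight_lt_of_sum_lt (by rw [sum_add_single]; exact Nat.lt_succ_self _)

namespace IsSkewPBWExtension

variable {A : Type*} [Ring A] {R : Subring A} {n : ℕ} {x : Fin n → A}

theorem sigmaPow_single (h : IsSkewPBWExtension R x) (i : Fin n) :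
    h.sigmaPow (Pi.single i 1) = h.sigma i := by
  let f (k : Fin n) : Function.End R := ⇑(h.sigma k)
  change (List.ofFn fun k => f k ^ (Pi.single i 1 : Fin n → ℕ) k).prod = f i
  simpa using prod_ofFn_pow_add_single f 0 i fun _ _ => rfl

theorem SigmaCompatible.mul_sigma_eq_zero_iff {h : IsSkewPBWExtension R x}
    (hσ : h.SigmaCompatible) (i : Fin n) (a b : R) : a * h.sigma i b = 0 ↔ a * b = 0 := by
  rw [← sigmaPow_single]
  exact hσ a b _

theorem coe_mul_x_ne_coe (h : IsSkewPBWExtension R x) (i : Fin n) {a : R} (ha : a ≠ 0) (b : R) :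
    (a : A) * x i ≠ b := by
  intro e
  have h_coeff := h.repr_linear_single i a (-b)
  rw [NegMemClass.coe_neg, e, add_neg_cancel, map_zero] at h_coeff
  exact ha h_coeff.symm

theorem x_mul_smul (h : IsSkewPBWExtension R x) (i : Fin n) (r : R) (f : A) :
    x i * (r • f) = h.sigma i r • (x i * f) + h.delta i r • f := by
  simp only [Subring.smul_def, smul_eq_mul]
  rw [← mul_assoc, h.x_mul, add_mul, mul_assoc]

/-! ### Spans of standard monomials -/

/-- The left `R`-submodule of `A` spanned by the standard monomials with exponent in `s`. -/
def monomialSpan (R : Subring A) (x : Fin n → A) (s : Set (Fin n → ℕ)) : Submodule R A :=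
  Submodule.span R (stdMonomial x '' s)

theorem stdMonomial_mem_monomialSpan {s : Set (Fin n → ℕ)} {α : Fin n → ℕ} (hα : α ∈ s) :
    stdMonomial x α ∈ monomialSpan R x s :=
  Submodule.subset_span (Set.mem_image_of_mem _ hα)

theorem monomialSpan_mono {s t : Set (Fin n → ℕ)} (hst : s ⊆ t) :
    monomialSpan R x s ≤ monomialSpan R x t :=
  Submodule.span_mono (Set.image_mono hst)

theorem coe_basis (h : IsSkewPBWExtension R x) : ⇑h.basis = stdMonomial x :=
  Module.Basis.coe_mk _ _

theorem mem_monomialSpan_iff (h : IsSkewPBWExtension R x) {s : Set (Fin n → ℕ)} {f : A} :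
    f ∈ monomialSpan R x s ↔ ↑(h.basis.repr f).support ⊆ s := by
  rw [monomialSpan, ← h.coe_basis, Module.Basis.mem_span_image]

theorem eq_of_smul_stdMonomial_smodEq (h : IsSkewPBWExtension R x) {s : Set (Fin n → ℕ)}
    {α : Fin n → ℕ} (hα : α ∉ s) {a b : R}
    (hab : a • stdMonomial x α ≡ b • stdMonomial x α [SMOD monomialSpan R x s]) : a = b := by
  rw [SModEq.sub_mem, ← sub_smul, h.mem_monomialSpan_iff, ← h.coe_basis] at hab
  by_contra hne
  exact hα (hab (by simpa [sub_eq_zero] using hne))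

theorem x_mul_mem_of_mem_monomialSpan (h : IsSkewPBWExtension R x) (i : Fin n)
    {s : Set (Fin n → ℕ)} {U : Submodule R A} (hs : ∀ α ∈ s, stdMonomial x α ∈ U)
    (hxs : ∀ α ∈ s, x i * stdMonomial x α ∈ U) {f : A} (hf : f ∈ monomialSpan R x s) :
    x i * f ∈ U := by
  induction hf using Submodule.closure_induction with
  | zero => simp
  | add f g _ _ hf hg => simpa only [mul_add] using add_mem hf hg
  | smul_mem r f hf =>
    obtain ⟨α, hα, rfl⟩ := hf
    rw [h.x_mul_smul]
    exact add_mem (U.smul_mem _ (hxs α hα)) (U.smul_mem _ (hs α hα))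

/-- The elements of `A` of total degree at most `d`. -/
def degreeLE (R : Subring A) (x : Fin n → A) (d : ℕ) : Submodule R A :=
  monomialSpan R x {α | ∑ k, α k ≤ d}

/-- The elements of `A` all of whose exponents are below `γ` in the degree-lexicographic order. -/
def below (R : Subring A) (x : Fin n → A) (γ : Fin n → ℕ) : Submodule R A :=
  monomialSpan R x {β | degLexWeight β < degLexWeight γ}

theorem degreeLE_mono {d e : ℕ} (hde : d ≤ e) : degreeLE R x d ≤ degreeLE R x e :=
  monomialSpan_mono fun _ hα => le_trans hα hde

theorem below_mono {β γ : Fin n → ℕ} (h : degLexWeight β ≤ degLexWeight γ) :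
    below R x β ≤ below R x γ :=
  monomialSpan_mono fun _ hα => lt_of_lt_of_le hα h

theorem degreeLE_le_below {d : ℕ} {γ : Fin n → ℕ} (hd : d < ∑ k, γ k) :
    degreeLE R x d ≤ below R x γ :=
  monomialSpan_mono fun _ hα => degLexWeight_lt_of_sum_lt (lt_of_le_of_lt hα hd)

/-! ### Multiplying a standard monomial by a variable -/

/-- The submodule `R + R x_1 + ⋯ + R x_n`, to which the relations between the variables
belong. -/
def affineForms (R : Subring A) (x : Fin n → A) : Submodule R A :=
  Submodule.span R (insert 1 (Set.range x))

theorem affineForms_le_degreeLE_one : affineForms R x ≤ degreeLE R x 1 := by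
  refine Submodule.span_le.2 (Set.insert_subset ?_ (Set.range_subset_iff.2 fun k => ?_))
  · rw [← stdMonomial_zero x]
    exact stdMonomial_mem_monomialSpan (by simp)
  · rw [← stdMonomial_single x k]
    exact stdMonomial_mem_monomialSpan (by simp)

theorem mul_mem_of_mem_affineForms {U : Submodule R A} {f g : A} (hg : g ∈ U)
    (hxg : ∀ k, x k * g ∈ U) (hf : f ∈ affineForms R x) : f * g ∈ U := by
  induction hf using Submodule.span_induction with
  | mem f hf =>
    rcases hf with rfl | ⟨k, rfl⟩
    · rwa [one_mul]
    · exact hxg k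
  | zero => simp
  | add f₁ f₂ _ _ h₁ h₂ => simpa only [add_mul] using add_mem h₁ h₂
  | smul r f _ hf => simpa only [smul_mul_assoc] using U.smul_mem r hf

theorem exists_x_mul_x_smodEq (h : IsSkewPBWExtension R x) (i j : Fin n) :
    ∃ d : R, x i * x j ≡ d • (x j * x i) [SMOD affineForms R x] := by
  obtain ⟨d, -, r₀, r, hd⟩ := h.exists_comm j i
  refine ⟨d, SModEq.sub_mem.2 ?_⟩
  have h_affine : x i * x j - d • (x j * x i) = r₀ • (1 : A) + ∑ k, r k • x k := by
    simpa [Subring.smul_def] using hd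
  rw [h_affine]
  exact add_mem (Submodule.smul_mem _ _ (Submodule.subset_span (Set.mem_insert _ _)))
    (Submodule.sum_mem _ fun k _ => Submodule.smul_mem _ _
      (Submodule.subset_span (Set.mem_insert_of_mem _ (Set.mem_range_self k))))

theorem exists_isUnit_x_mul_x_smodEq (h : IsSkewPBWExtension R x) [IsDedekindFiniteMonoid R]
    {i j : Fin n} (hji : j < i) :
    ∃ d : R, IsUnit d ∧ x i * x j ≡ d • (x j * x i) [SMOD affineForms R x] := by
  obtain ⟨d, hd⟩ := h.exists_x_mul_x_smodEq i j
  obtain ⟨d', hd'⟩ := h.exists_x_mul_x_smodEq j i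
  have h_std : x j * x i = stdMonomial x (Pi.single i 1 + Pi.single j 1) := by
    rw [stdMonomial_add_single, stdMonomial_single]
    exact fun k hk => Pi.single_eq_of_ne (hk.trans hji).ne 1
  have h_twice : (1 : R) • (x j * x i) ≡ (d' * d) • (x j * x i) [SMOD affineForms R x] := by
    rw [one_smul, mul_smul]
    exact hd'.trans (hd.smul d')
  have hd'd : 1 = d' * d := by
    rw [h_std] at h_twice
    refine h.eq_of_smul_stdMonomial_smodEq ?_ (h_twice.mono affineForms_le_degreeLE_one)
    simp [Finset.sum_add_distrib]
  exact ⟨d, .of_mul_eq_one_right d' hd'd.symm, hd⟩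

theorem x_mul_smodEq_degreeLE (h : IsSkewPBWExtension R x) {d : ℕ} (i : Fin n)
    (hd : ∀ β : Fin n → ℕ, ∑ k, β k ≤ d → x i * stdMonomial x β ∈ degreeLE R x (d + 1)) {f g : A}
    (hfg : f ≡ g [SMOD degreeLE R x d]) : x i * f ≡ x i * g [SMOD degreeLE R x (d + 1)] := by
  rw [SModEq.sub_mem, ← mul_sub]
  exact h.x_mul_mem_of_mem_monomialSpan i
    (fun α hα => degreeLE_mono d.le_succ (stdMonomial_mem_monomialSpan hα)) hd
    (SModEq.sub_mem.1 hfg)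

theorem mem_degreeLE_of_smodEq {d : ℕ} {β : Fin n → ℕ} {f : A} {u : R} {i : Fin n}
    (hβ : ∑ k, β k ≤ d)
    (hf : f ≡ u • stdMonomial x (β + Pi.single i 1) [SMOD degreeLE R x (∑ k, β k)]) :
    f ∈ degreeLE R x (d + 1) := by
  rw [SModEq.sub_mem] at hf
  rw [← sub_add_cancel f (u • stdMonomial x (β + Pi.single i 1))]
  refine add_mem (degreeLE_mono (hβ.trans d.le_succ) hf) (Submodule.smul_mem _ _
    (stdMonomial_mem_monomialSpan ?_))
  exact (sum_add_single β i).trans_le (Nat.succ_le_succ hβ)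

theorem exists_isUnit_x_mul_stdMonomial_add_single (h : IsSkewPBWExtension R x)
    [IsDedekindFiniteMonoid R] {i j : Fin n} (hji : j < i) {α : Fin n → ℕ}
    (hα : ∀ k < j, α k = 0)
    (h_deg : ∀ (k : Fin n) (β : Fin n → ℕ), ∑ l, β l ≤ ∑ l, α l →
      x k * stdMonomial x β ∈ degreeLE R x (∑ l, α l + 1))
    {u : R} (hu : IsUnit u) (h_lead : x i * stdMonomial x α ≡
      u • stdMonomial x (α + Pi.single i 1) [SMOD degreeLE R x (∑ l, α l)]) :
    ∃ v : R, IsUnit v ∧ x i * stdMonomial x (α + Pi.single j 1) ≡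
      v • stdMonomial x (α + Pi.single j 1 + Pi.single i 1) [SMOD degreeLE R x (∑ l, α l + 1)] := by
  obtain ⟨d, hd, h_comm⟩ := h.exists_isUnit_x_mul_x_smodEq hji
  have h_swap : x i * (x j * stdMonomial x α) ≡ d • (x j * (x i * stdMonomial x α))
      [SMOD degreeLE R x (∑ l, α l + 1)] := by
    rw [SModEq.sub_mem, ← mul_assoc, ← mul_assoc, ← smul_mul_assoc, ← sub_mul]
    exact mul_mem_of_mem_affineForms (stdMonomial_mem_monomialSpan (Nat.le_succ _))
      (fun k => h_deg k α le_rfl) (SModEq.sub_mem.1 h_comm)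
  have h_std : x j * stdMonomial x (α + Pi.single i 1) =
      stdMonomial x (α + Pi.single j 1 + Pi.single i 1) := by
    rw [add_right_comm, stdMonomial_add_single x (α + Pi.single i 1) j]
    exact fun k hk => by simp [hα k hk, (hk.trans hji).ne]
  have h_move : x j * (u • stdMonomial x (α + Pi.single i 1)) ≡
      h.sigma j u • stdMonomial x (α + Pi.single j 1 + Pi.single i 1)
      [SMOD degreeLE R x (∑ l, α l + 1)] := by
    rw [h.x_mul_smul, h_std, SModEq.sub_mem, add_sub_cancel_left]
    exact Submodule.smul_mem _ _ (stdMonomial_mem_monomialSpan (sum_add_single α i).le)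
  refine ⟨d * h.sigma j u, hd.mul (hu.map _), ?_⟩
  rw [stdMonomial_add_single x α j hα, mul_smul]
  exact h_swap.trans (((h.x_mul_smodEq_degreeLE j (h_deg j) h_lead).trans h_move).smul d)

theorem exists_isUnit_x_mul_stdMonomial_smodEq (h : IsSkewPBWExtension R x)
    [IsDedekindFiniteMonoid R] (i : Fin n) (β : Fin n → ℕ) :
    ∃ u : R, IsUnit u ∧ x i * stdMonomial x β ≡ u • stdMonomial x (β + Pi.single i 1)
      [SMOD degreeLE R x (∑ k, β k)] := by
  induction hd : ∑ k, β k using Nat.strong_induction_on generalizing i β with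
  | _ d ih =>
  by_cases hβi : ∀ k < i, β k = 0
  · refine ⟨1, isUnit_one, ?_⟩
    rw [one_smul, stdMonomial_add_single x β i hβi]
  obtain ⟨j, α, rfl, hα⟩ := exists_eq_add_single_first (α := β)
    fun h0 => hβi fun _ _ => by simp [h0]
  have hji : j < i := by
    by_contra! hij
    exact hβi fun k hk => by simp [hα k (hk.trans_le hij), (hk.trans_le hij).ne]
  rw [sum_add_single] at hd
  subst hd
  obtain ⟨u, hu, h_lead⟩ := ih _ (Nat.lt_succ_self _) i α rfl
  refine h.exists_isUnit_x_mul_stdMonomial_add_single hji hα (fun k β hβ => ?_) hu h_lead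
  obtain ⟨v, -, hv⟩ := ih _ (Nat.lt_succ_of_le hβ) k β rfl
  exact mem_degreeLE_of_smodEq hβ hv

/-! ### Leading terms -/

/-- `f` is `a x^α` plus terms that are smaller in the degree-lexicographic order, so that `a x^α`
is the leading term of `f` when `a ≠ 0`. The case `a = 0` is allowed: it makes the notion stable
under products. -/
def HasLeadingTerm (R : Subring A) (x : Fin n → A) (f : A) (α : Fin n → ℕ) (a : R) : Prop :=
  f ≡ a • stdMonomial x α [SMOD below R x α]

theorem exists_hasLeadingTerm (h : IsSkewPBWExtension R x) {f : A} (hf : f ≠ 0) :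
    ∃ (α : Fin n → ℕ) (a : R), a ≠ 0 ∧ HasLeadingTerm R x f α a := by
  have h_supp : (h.basis.repr f).support.Nonempty := by simpa using hf
  obtain ⟨α, hα, hmax⟩ := Finset.exists_max_image _ degLexWeight h_supp
  refine ⟨α, h.basis.repr f α, Finsupp.mem_support_iff.1 hα, SModEq.sub_mem.2 ?_⟩
  refine h.mem_monomialSpan_iff.2 fun β hβ => ?_
  rw [← h.coe_basis, map_sub, map_smul, Module.Basis.repr_self, Finsupp.smul_single,
    smul_eq_mul, mul_one, ← Finsupp.erase_eq_sub_single, Finsupp.support_erase] at hβ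
  obtain ⟨hne, hβ⟩ := Finset.mem_erase.1 hβ
  exact lt_of_le_of_ne (hmax β hβ) (degLexWeight_injective.ne hne)

theorem HasLeadingTerm.mem_below {f : A} {α γ : Fin n → ℕ} {a : R}
    (hf : HasLeadingTerm R x f α a) (hαγ : degLexWeight α < degLexWeight γ) :
    f ∈ below R x γ := by
  rw [← sub_add_cancel f (a • stdMonomial x α)]
  exact add_mem (below_mono hαγ.le (SModEq.sub_mem.1 hf))
    (Submodule.smul_mem _ _ (stdMonomial_mem_monomialSpan hαγ))

theorem HasLeadingTerm.eq_zero (h : IsSkewPBWExtension R x) {α : Fin n → ℕ} {a : R}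
    (h0 : HasLeadingTerm R x 0 α a) : a = 0 :=
  (h.eq_of_smul_stdMonomial_smodEq (lt_irrefl (degLexWeight α)) (by rwa [zero_smul])).symm

section Multiplication

variable [IsDedekindFiniteMonoid R]

theorem exists_isUnit_hasLeadingTerm_x_mul_stdMonomial (h : IsSkewPBWExtension R x) (i : Fin n)
    (β : Fin n → ℕ) :
    ∃ u : R, IsUnit u ∧ HasLeadingTerm R x (x i * stdMonomial x β) (β + Pi.single i 1) u := by
  obtain ⟨u, hu, h_lead⟩ := h.exists_isUnit_x_mul_stdMonomial_smodEq i β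
  refine ⟨u, hu, h_lead.mono (degreeLE_le_below ?_)⟩
  rw [sum_add_single]
  exact Nat.lt_succ_self _

theorem HasLeadingTerm.x_mul {h : IsSkewPBWExtension R x} (hσ : h.SigmaCompatible) (i : Fin n)
    {g : A} {β : Fin n → ℕ} {b : R} (hg : HasLeadingTerm R x g β b) :
    ∃ b' : R, (∀ a, a * b' = 0 → a * b = 0) ∧
      HasLeadingTerm R x (x i * g) (β + Pi.single i 1) b' := by
  obtain ⟨u, hu, h_lead⟩ := h.exists_isUnit_hasLeadingTerm_x_mul_stdMonomial i β
  refine ⟨h.sigma i b * u, fun a ha => ?_, ?_⟩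
  · rwa [← mul_assoc, hu.mul_left_eq_zero, hσ.mul_sigma_eq_zero_iff] at ha
  have h_lower : x i * g ≡ x i * (b • stdMonomial x β) [SMOD below R x (β + Pi.single i 1)] := by
    rw [SModEq.sub_mem, ← mul_sub]
    refine h.x_mul_mem_of_mem_monomialSpan i (fun γ hγ => ?_) (fun γ hγ => ?_)
      (SModEq.sub_mem.1 hg)
    · exact stdMonomial_mem_monomialSpan (hγ.trans (degLexWeight_lt_add_single β i))
    · obtain ⟨v, -, hv⟩ := h.exists_isUnit_hasLeadingTerm_x_mul_stdMonomial i γ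
      exact hv.mem_below (degLexWeight_add_lt_add_right hγ _)
  have h_delta : h.delta i b • stdMonomial x β ≡ 0 [SMOD below R x (β + Pi.single i 1)] :=
    SModEq.zero.2 (Submodule.smul_mem _ _
      (stdMonomial_mem_monomialSpan (degLexWeight_lt_add_single β i)))
  refine h_lower.trans ?_
  rw [h.x_mul_smul, mul_smul]
  simpa only [add_zero] using (h_lead.smul (h.sigma i b)).add h_delta

theorem HasLeadingTerm.stdMonomial_mul {h : IsSkewPBWExtension R x} (hσ : h.SigmaCompatible)
    (α : Fin n → ℕ) {g : A} {β : Fin n → ℕ} {b : R} (hg : HasLeadingTerm R x g β b) :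
    ∃ b' : R, (∀ a, a * b' = 0 → a * b = 0) ∧
      HasLeadingTerm R x (stdMonomial x α * g) (α + β) b' := by
  induction hd : ∑ k, α k generalizing α with
  | zero =>
    obtain rfl : α = 0 := funext fun k => (Finset.sum_eq_zero_iff.1 hd) k (Finset.mem_univ k)
    exact ⟨b, fun _ => id, by rwa [stdMonomial_zero, one_mul, zero_add]⟩
  | succ d ih =>
    obtain ⟨j, γ, rfl, hγ⟩ := exists_eq_add_single_first (α := α) (by rintro rfl; simp at hd)
    rw [sum_add_single, Nat.succ_inj] at hd
    obtain ⟨b₁, hb₁, h_lead₁⟩ := ih γ hd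
    obtain ⟨b₂, hb₂, h_lead₂⟩ := h_lead₁.x_mul hσ j
    refine ⟨b₂, fun a ha => hb₁ a (hb₂ a ha), ?_⟩
    rwa [stdMonomial_add_single x γ j hγ, mul_assoc, add_right_comm]

theorem HasLeadingTerm.mul {h : IsSkewPBWExtension R x} (hσ : h.SigmaCompatible) {f g : A}
    {α β : Fin n → ℕ} {a b : R} (hf : HasLeadingTerm R x f α a) (hg : HasLeadingTerm R x g β b) :
    ∃ c : R, (c = 0 → a * b = 0) ∧ HasLeadingTerm R x (f * g) (α + β) c := by
  obtain ⟨b', hb', h_lead⟩ := hg.stdMonomial_mul hσ α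
  refine ⟨a * b', hb' a, ?_⟩
  have h_lower {p : A} (hp : p ∈ below R x α) : p * g ∈ below R x (α + β) := by
    induction hp using Submodule.span_induction with
    | mem p hp =>
      obtain ⟨γ, hγ, rfl⟩ := hp
      obtain ⟨c, -, hc⟩ := hg.stdMonomial_mul hσ γ
      exact hc.mem_below (degLexWeight_add_lt_add_right hγ β)
    | zero => simp
    | add p q _ _ hp hq => simpa only [add_mul] using add_mem hp hq
    | smul r p _ hp => simpa only [smul_mul_assoc] using Submodule.smul_mem _ r hp
  calc f * g ≡ a • (stdMonomial x α * g) [SMOD below R x (α + β)] := by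
        rw [SModEq.sub_mem, ← smul_mul_assoc, ← sub_mul]
        exact h_lower (SModEq.sub_mem.1 hf)
    _ ≡ (a * b') • stdMonomial x (α + β) [SMOD below R x (α + β)] := by
        rw [mul_smul]
        exact h_lead.smul a

theorem HasLeadingTerm.mul_eq_zero {h : IsSkewPBWExtension R x} (hσ : h.SigmaCompatible)
    {f g : A} {α β : Fin n → ℕ} {a b : R} (hf : HasLeadingTerm R x f α a)
    (hg : HasLeadingTerm R x g β b) (hfg : f * g = 0) : a * b = 0 := by
  obtain ⟨c, hc, h_lead⟩ := hf.mul hσ hg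
  rw [hfg] at h_lead
  exact hc (h_lead.eq_zero h)

end Multiplication

theorem isReduced (h : IsSkewPBWExtension R x) [IsReduced R] (hσ : h.SigmaCompatible) :
    IsReduced A := by
  have := isDedekindFiniteMonoid_of_isReduced (S := R)
  refine (isReduced_iff_pow_one_lt 2 one_lt_two).2 fun f hff => ?_
  by_contra hf
  obtain ⟨α, a, ha, h_lead⟩ := h.exists_hasLeadingTerm hf
  have haa : a * a = 0 := h_lead.mul_eq_zero hσ h_lead (by rwa [← sq])
  exact ha (IsReduced.eq_zero a ⟨2, by rwa [sq]⟩)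

/-! ### The girth of the nilpotent graph of a skew PBW extension -/

theorem egirth_nilpotentGraph_ne_three (h : IsSkewPBWExtension R x) [IsReduced R]
    (hσ : h.SigmaCompatible) (hR : (nilpotentGraph R).egirth ≠ 3) :
    (nilpotentGraph A).egirth ≠ 3 := by
  have := isDedekindFiniteMonoid_of_isReduced (S := R)
  have := h.isReduced hσ
  rw [Ne, egirth_nilpotentGraph_eq_three_iff_of_isReduced] at hR ⊢
  rintro ⟨p, q, r, ⟨hp, hq, hr⟩, hpq, hpr, hqr⟩
  obtain ⟨α, a, ha, hp_lead⟩ := h.exists_hasLeadingTerm hp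
  obtain ⟨β, b, hb, hq_lead⟩ := h.exists_hasLeadingTerm hq
  obtain ⟨γ, c, hc, hr_lead⟩ := h.exists_hasLeadingTerm hr
  exact hR ⟨a, b, c, ⟨ha, hb, hc⟩, hp_lead.mul_eq_zero hσ hq_lead hpq,
    hp_lead.mul_eq_zero hσ hr_lead hpr, hq_lead.mul_eq_zero hσ hr_lead hqr⟩

theorem egirth_nilpotentGraph_eq_four (h : IsSkewPBWExtension R x) [IsReduced R]
    (hσ : h.SigmaCompatible) (i : Fin n) (hR : (nilpotentGraph R).egirth ≠ 3)
    (hne : (nilZeroDivisors R).Nonempty) : (nilpotentGraph A).egirth = 4 := by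
  have := h.isReduced hσ
  obtain ⟨a, ha, b, hb, hab⟩ := hne
  have hab_coe : (a : A) * (b : A) = 0 := by
    rw [← Subring.coe_mul, mem_nilSet_iff_eq_zero.1 hab, ZeroMemClass.coe_zero]
  refine le_antisymm (egirth_nilpotentGraph_le_four_of_isReduced (a := (a : A)) (b := b)
    (y := x i) (by simpa using ha) (by simpa using hb) hab_coe (h.coe_mul_x_ne_coe i ha 0)
    (h.coe_mul_x_ne_coe i hb 0) (h.coe_mul_x_ne_coe i ha a) (h.coe_mul_x_ne_coe i hb b)) ?_
  exact Order.add_one_le_of_lt (lt_of_le_of_ne SimpleGraph.three_le_egirth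
    (h.egirth_nilpotentGraph_ne_three hσ hR).symm)

theorem egirth_nilpotentGraph_eq_three (h : IsSkewPBWExtension R x) (i : Fin n) {a : R}
    (ha : a ≠ 0) (haa : a * a = 0) : (nilpotentGraph A).egirth = 3 := by
  by_contra hA
  have haa_coe : (a : A) * (a : A) = 0 := by rw [← Subring.coe_mul, haa, ZeroMemClass.coe_zero]
  rcases mul_eq_zero_or_mul_eq_self hA (by simpa using ha) haa_coe (x i) with h0 | h1
  · exact h.coe_mul_x_ne_coe i ha 0 h0
  · exact h.coe_mul_x_ne_coe i ha a h1

end IsSkewPBWExtension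

theorem mainTheorem5_general {A : Type*} [Ring A] (R : Subring A) {n : ℕ} (hn : 1 ≤ n)
    (x : Fin n → A) (hA : IsSkewPBWExtension R x) (hσ : hA.SigmaCompatible)
    (hgirth : (nilpotentGraph R).egirth ≠ 3) (hne : (nilZeroDivisors R).Nonempty) :
    ((nilSet R).ncard = 2 ∧ (nilpotentGraph A).egirth = 3) ∨
      (IsReduced R ∧ (nilpotentGraph A).egirth = 4) := by
  let i : Fin n := ⟨0, hn⟩
  by_cases hred : IsReduced R
  · exact Or.inr ⟨hred, hA.egirth_nilpotentGraph_eq_four hσ i hgirth hne⟩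
  · simp only [isReduced_iff_pow_one_lt 2 one_lt_two, not_forall, sq] at hred
    obtain ⟨a, haa, ha⟩ := hred
    refine Or.inl ⟨?_, hA.egirth_nilpotentGraph_eq_three i ha haa⟩
    rw [nilSet_eq_pair hgirth ha haa, Set.ncard_pair (Ne.symm ha)]

theorem mainTheorem5 {A : Type*} [Ring A] (R : Subring A) {n : ℕ} (hn : 1 ≤ n) (x : Fin n → A)
    (hA : IsSkewPBWExtension R x) (hcompat : hA.Compatible) (hprimal : IsTwoPrimal R)
    (hgirth : (nilpotentGraph R).egirth = ⊤) (hne : (nilZeroDivisors R).Nonempty) :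
    ((nilSet R).ncard = 2 ∧ (nilpotentGraph A).egirth = 3) ∨
      (IsReduced R ∧ (nilpotentGraph A).egirth = 4) :=
  mainTheorem5_general R hn x hA hcompat.1 (hgirth ▸ ENat.top_ne_ofNat 3) hne
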